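/- Let $r\ge 1$ and let $S:\mathbb R^{r+1}\to\mathbb R$, $S=S(\xi_0,\dots,\xi_r)$, be a $C^2$ function such that 1. $S(\xi_0+1,\dots,\xi_r+1)=S(\xi_0,\dots,\xi_r)$ for all $\xi$; 2. all second partial derivatives of $S$ are bounded on $\mathbb R^{r+1}$; 3. $S(\xi)\to\infty$ as $\sup_{0\le j\le r}|\xi_0-\xi_j|\to\infty$; 4. (weak twist condition) $\partial_{j,k}S\le 0$ for all $j\ne k$, and there is $\lambda>0$ with $\partial_{0,1}S<-\lambda$ everywhere. (The local energies $S(\xi)=\sum_{j=1}^r f_j(\xi_0,\xi_j)$ with the strong twist condition, i.e. with $f_j\in C^2(\mathbb R^2)$ satisfying $f_j(\nu+1,\mu+1)=f_j(\nu,\mu)$, having bounded second derivatives, $f_j(\nu,\mu)\to\infty$ as $|\nu-\mu|\to\infty$, and $\partial_{1,2}f_j\le-\lambda_j<0$ for some constant $\lambda_j$, for every $j$, are special cases.) For $x\in\mathbb R^{\mathbb Z}$ put $S_i(x)=S(x_i,\dots,x_{i+r})$, and call $x$ a global minimizer if for all integers $i_0\le i_1$ and every $v\in\mathbb R^{\mathbb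 Z}$ supported in $[i_0,i_1]$, $$\sum_{i=i_0-r}^{i_1}S_i(x)\le\sum_{i=i_0-r}^{i_1}S_i(x+v).$$ Write $(\tau_{k,l}x)_i=x_{i-k}+l$ for $k,l\in\mathbb Z$, and $x\le y$ if $x_i\le y_i$ for all $i$. Call $x$ Birkhoff if for all $k,l\in\mathbb Z$ one has $\tau_{k,l}x\le x$ or $\tau_{k,l}x\ge x$, and say that $x$ has rotation number $\nu$ if $x_n/n\to\nu$ as $n\to+\infty$ and as $n\to-\infty$. For integers $p\neq 0$ and $q$, let $\mathcal{BM}^+_{q/p}$ (respectively $\mathcal{BM}^-_{q/p}$) be the set of Birkhoff global minimizers $x$ of rotation number $q/p$ with $\tau_{p,q}x\ge x$ (respectively $\tau_{p,q}x\le x$). **Theorem.** For all integers $p\ne0$ and $q$, each of the sets $\mathcal{BM}^+_{q/p}$ and $\mathcal{BM}^-_{q/p}$ is totally ordered by $\le$: any two of its elements $x,y$ satisfy $x\le y$ or $y\le x$. -/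

import Mathlib

open Filter Topology

namespace FrenkelKontorova

noncomputable section

/-- The partial derivative `∂ₖ F` of a function of finitely many real variables. -/
def partialDeriv {n : ℕ} (k : Fin n) (F : (Fin n → ℝ) → ℝ) (ξ : Fin n → ℝ) : ℝ :=
  fderiv ℝ F ξ (Pi.single k 1)

/-- The second partial derivative `∂_{j,k} F`. -/
def partialDeriv₂ {n : ℕ} (j k : Fin n) (F : (Fin n → ℝ) → ℝ) (ξ : Fin n → ℝ) : ℝ :=
  partialDeriv j (partialDeriv k F) ξ

/-- Local energies `S : ℝ^{r+1} → ℝ` of range `r ≥ 1` under the strong twist condition: `S` is a sum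
of pair potentials `f_j(ξ_0, ξ_j)`, `1 ≤ j ≤ r` (the variables of `S` are numbered `0, …, r`). -/
def IsStrongTwistLocalEnergy {r : ℕ} (S : (Fin (r + 1) → ℝ) → ℝ) : Prop :=
  1 ≤ r ∧ ∃ f : Fin r → (Fin 2 → ℝ) → ℝ,
    (∀ ξ, S ξ = ∑ j, f j ![ξ 0, ξ j.succ]) ∧
    ∀ j,
      ContDiff ℝ 2 (f j) ∧
      (∀ ν μ, f j ![ν + 1, μ + 1] = f j ![ν, μ]) ∧
      (∃ K > 0, ∀ a b z, |partialDeriv₂ a b (f j) z| ≤ K / r) ∧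
      (∀ C, ∃ R, ∀ ν μ, R ≤ |ν - μ| → C ≤ f j ![ν, μ]) ∧
      (∃ lam > 0, ∀ z, partialDeriv₂ 0 1 (f j) z ≤ -lam)

/-- Local energies `S : ℝ^{r+1} → ℝ` of range `r ≥ 1` under the weak twist condition. The variables of
`S` are numbered `0, …, r`. -/
structure IsWeakTwistLocalEnergy {r : ℕ} (S : (Fin (r + 1) → ℝ) → ℝ) : Prop where
  one_le_range : 1 ≤ r
  contDiff : ContDiff ℝ 2 S
  periodic : ∀ ξ, S (fun i => ξ i + 1) = S ξ
  bounded_second : ∃ K, ∀ j k ξ, |partialDeriv₂ j k S ξ| ≤ K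
  /-- `S ξ → ∞` as `sup_j |ξ_0 - ξ_j| → ∞`. -/
  coercive : ∀ C, ∃ R, ∀ ξ, (∃ j, R ≤ |ξ 0 - ξ j|) → C ≤ S ξ
  twist_nonpos : ∀ j k, j ≠ k → ∀ ξ, partialDeriv₂ j k S ξ ≤ 0
  twist_neg : ∃ lam > 0, ∀ ξ, partialDeriv₂ 0 1 S ξ < -lam

/-- `S_j(x) = S(x_j, …, x_{j+r})`. -/
def localEnergyAt {r : ℕ} (S : (Fin (r + 1) → ℝ) → ℝ) (j : ℤ) (x : ℤ → ℝ) : ℝ :=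
  S fun m => x (j + (m : ℕ))

/-- `W_B(x) = ∑_{i ∈ B} S_i(x)` for the segment `B = [i₀ - r, i₁]`. -/
def segmentAction {r : ℕ} (S : (Fin (r + 1) → ℝ) → ℝ) (i₀ i₁ : ℤ) (x : ℤ → ℝ) : ℝ :=
  ∑ i ∈ Finset.Icc (i₀ - r) i₁, localEnergyAt S i x

/-- `x` minimizes every `W_B`, `B = [i₀ - r, i₁]`, among variations supported in `[i₀, i₁]`. -/
def IsGlobalMinimizer {r : ℕ} (S : (Fin (r + 1) → ℝ) → ℝ) (x : ℤ → ℝ) : Prop :=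
  ∀ i₀ i₁ : ℤ, i₀ ≤ i₁ → ∀ v : ℤ → ℝ, Function.support v ⊆ Set.Icc i₀ i₁ →
    segmentAction S i₀ i₁ x ≤ segmentAction S i₀ i₁ (x + v)

/-- The translation `(τ_{k,l} x)_i = x_{i-k} + l`. -/
def translate (k l : ℤ) (x : ℤ → ℝ) : ℤ → ℝ := fun i => x (i - k) + l

/-- Sequences are compared termwise: `x ≤ y` means `x_i ≤ y_i` for all `i`. -/
def IsBirkhoff (x : ℤ → ℝ) : Prop :=
  ∀ k l : ℤ, translate k l x ≤ x ∨ x ≤ translate k l x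

def HasRotationNumber (x : ℤ → ℝ) (ν : ℝ) : Prop :=
  Tendsto (fun n : ℤ => x n / n) atTop (𝓝 ν) ∧ Tendsto (fun n : ℤ => x n / n) atBot (𝓝 ν)

/-- `BM_ν`: the Birkhoff global minimizers of rotation number `ν`. -/
def birkhoffMinimizers {r : ℕ} (S : (Fin (r + 1) → ℝ) → ℝ) (ν : ℝ) : Set (ℤ → ℝ) :=
  {x | IsGlobalMinimizer S x ∧ IsBirkhoff x ∧ HasRotationNumber x ν}

/-- `BM⁺_{q/p}`. -/
def birkhoffMinimizersPlus {r : ℕ} (S : (Fin (r + 1) → ℝ) → ℝ) (p q : ℤ) : Set (ℤ → ℝ) :=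
  {x ∈ birkhoffMinimizers S ((q : ℝ) / p) | x ≤ translate p q x}

/-- `BM⁻_{q/p}`. -/
def birkhoffMinimizersMinus {r : ℕ} (S : (Fin (r + 1) → ℝ) → ℝ) (p q : ℤ) : Set (ℤ → ℝ) :=
  {x ∈ birkhoffMinimizers S ((q : ℝ) / p) | translate p q x ≤ x}

/-! The strong twist condition implies the weak one. -/

def pairMap {r : ℕ} (j : Fin r) : (Fin (r + 1) → ℝ) →L[ℝ] (Fin 2 → ℝ) :=
  ContinuousLinearMap.pi ![ContinuousLinearMap.proj 0, ContinuousLinearMap.proj j.succ]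

theorem pairMap_apply {r : ℕ} (j : Fin r) (ξ : Fin (r + 1) → ℝ) :
    pairMap j ξ = ![ξ 0, ξ j.succ] := by
  ext i; fin_cases i <;> simp [pairMap]

theorem pairMap_single {r : ℕ} (j : Fin r) (a : Fin (r + 1)) :
    pairMap j (Pi.single a 1) =
      if a = 0 then Pi.single 0 1 else if a = j.succ then Pi.single 1 1 else 0 := by
  rw [pairMap_apply]
  have h0 : (0 : Fin (r + 1)) ≠ j.succ := (Fin.succ_ne_zero j).symm
  split_ifs with h1 h2
  · subst h1; ext i; fin_cases i <;> simp
  · subst h2; ext i; fin_cases i <;> simp [h0]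
  · ext i; fin_cases i <;> simp [Ne.symm h1, Ne.symm h2]

theorem partialDeriv₂_sum {r : ℕ} (f : Fin r → (Fin 2 → ℝ) → ℝ) (hf : ∀ j, ContDiff ℝ 2 (f j))
    (a b : Fin (r + 1)) (ξ : Fin (r + 1) → ℝ) :
    partialDeriv₂ a b (fun ξ => ∑ j, f j ![ξ 0, ξ j.succ]) ξ =
      ∑ j, fderiv ℝ (fun z => fderiv ℝ (f j) z (pairMap j (Pi.single b 1))) ![ξ 0, ξ j.succ]
        (pairMap j (Pi.single a 1)) := by
  have hd : ∀ j z, DifferentiableAt ℝ (f j) z := fun j z =>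
    ((hf j).differentiable (by norm_num)) z
  have hd2 : ∀ j w, Differentiable ℝ (fun z => fderiv ℝ (f j) z w) := fun j w =>
    (((hf j).fderiv_right (m := 1) (by norm_num)).differentiable (by norm_num)).clm_apply
      (differentiable_const w)
  have h1 : partialDeriv b (fun ξ => ∑ j, f j ![ξ 0, ξ j.succ]) =
      fun ξ => ∑ j, fderiv ℝ (f j) (pairMap j ξ) (pairMap j (Pi.single b 1)) := by
    funext ζ
    have : HasFDerivAt (fun ξ => ∑ j, f j ![ξ 0, ξ j.succ])
        (∑ j, (fderiv ℝ (f j) (pairMap j ζ)).comp (pairMap j)) ζ := by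
      have := HasFDerivAt.fun_sum (u := Finset.univ) (fun j _ =>
        (hd j (pairMap j ζ)).hasFDerivAt.comp ζ (pairMap j).hasFDerivAt)
      simpa only [Function.comp_def, pairMap_apply] using this
    simp [partialDeriv, this.fderiv]
  have h2 : HasFDerivAt (fun ξ => ∑ j, fderiv ℝ (f j) (pairMap j ξ) (pairMap j (Pi.single b 1)))
      (∑ j, (fderiv ℝ (fun z => fderiv ℝ (f j) z (pairMap j (Pi.single b 1)))
        (pairMap j ξ)).comp (pairMap j)) ξ :=
    HasFDerivAt.fun_sum (u := Finset.univ) (fun j _ =>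
        ((hd2 j (pairMap j (Pi.single b 1))) (pairMap j ξ)).hasFDerivAt.comp ξ
          (pairMap j).hasFDerivAt)
  rw [partialDeriv₂, h1, partialDeriv, h2.fderiv]
  simp [pairMap_apply]

theorem exists_lower_bound (f : (Fin 2 → ℝ) → ℝ) (hf : Continuous f)
    (hp : ∀ ν μ, f ![ν + 1, μ + 1] = f ![ν, μ])
    (hc : ∀ C, ∃ R, ∀ ν μ, R ≤ |ν - μ| → C ≤ f ![ν, μ]) : ∃ m, ∀ ν μ, m ≤ f ![ν, μ] := by
  obtain ⟨R, hR⟩ := hc 0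
  let g : ℝ × ℝ → ℝ := fun z => f ![z.1, z.1 + z.2]
  have hg : Continuous g := hf.comp (by fun_prop)
  obtain ⟨m, hm⟩ := ((isCompact_Icc (a := (0 : ℝ)) (b := 1)).prod
    (isCompact_Icc (a := -R) (b := R))).bddBelow_image hg.continuousOn
  refine ⟨min m 0, fun ν μ => ?_⟩
  by_cases h : R ≤ |ν - μ|
  · exact (min_le_right _ _).trans (hR ν μ h)
  · have hper : Function.Periodic (fun t => f ![t, t + (μ - ν)]) 1 := by
      intro t
      have := hp t (t + (μ - ν))
      simp only [← this]
      congr 2; ring_nf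
    have h1 := hper.sub_int_mul_eq ⌊ν⌋ (x := ν)
    simp only [mul_one, add_sub_cancel] at h1
    rw [← h1]
    refine (min_le_left _ _).trans (hm ⟨(Int.fract ν, μ - ν), ⟨⟨Int.fract_nonneg _,
      (Int.fract_lt_one _).le⟩, ?_⟩, rfl⟩)
    rw [not_le, abs_lt] at h
    constructor <;> simp only <;> linarith [h.1, h.2]

/-- Every local energy with the strong twist condition is one with the weak twist condition. -/
theorem IsStrongTwistLocalEnergy.weak {r : ℕ} {S : (Fin (r + 1) → ℝ) → ℝ}
    (h : IsStrongTwistLocalEnergy S) : IsWeakTwistLocalEnergy S := by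
  obtain ⟨hr, f, hS, hf⟩ := h
  obtain rfl : S = fun ξ => ∑ j, f j ![ξ 0, ξ j.succ] := funext hS
  have hD := partialDeriv₂_sum f (fun j => (hf j).1)
  -- the summands of a second partial derivative
  have hT : ∀ a b j (z : Fin 2 → ℝ), fderiv ℝ (fun z => fderiv ℝ (f j) z
      (pairMap j (Pi.single b 1))) z (pairMap j (Pi.single a 1)) =
      if b ≠ 0 ∧ b ≠ j.succ ∨ a ≠ 0 ∧ a ≠ j.succ then 0 else
        partialDeriv₂ (if a = 0 then 0 else 1) (if b = 0 then 0 else 1) (f j) z := by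
    intro a b j z
    rw [pairMap_single, pairMap_single]
    simp only [partialDeriv₂, partialDeriv]
    by_cases a0 : a = 0 <;> by_cases b0 : b = 0 <;> by_cases a1 : a = j.succ <;>
      by_cases b1 : b = j.succ <;> simp [a0, b0, a1, b1] <;> rfl
  have hsymm : ∀ j z, partialDeriv₂ 1 0 (f j) z = partialDeriv₂ 0 1 (f j) z := by
    intro j z
    have hd : DifferentiableAt ℝ (fderiv ℝ (f j)) z :=
      ((hf j).1.fderiv_right (m := 1) (by norm_num)).differentiable (by norm_num) z
    have hs := ((hf j).1.contDiffAt (x := z)).isSymmSndFDerivAt (by simp)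
    have e : ∀ u w, fderiv ℝ (fun z => fderiv ℝ (f j) z u) z w =
        fderiv ℝ (fderiv ℝ (f j)) z w u := by
      intro u w
      rw [fderiv_clm_apply hd (differentiableAt_const u)]; simp
    simp only [partialDeriv₂, partialDeriv]
    unfold partialDeriv
    rw [e, e, hs.eq]
  refine ⟨hr, ?_, ?_, ?_, ?_, ?_, ?_⟩
  · refine ContDiff.sum fun j _ => ?_
    have := (hf j).1.comp (pairMap j).contDiff
    simpa only [Function.comp_def, pairMap_apply] using this
  · intro ξ
    exact Finset.sum_congr rfl fun j _ => (hf j).2.1 _ _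
  · choose K hK0 hK using fun j => (hf j).2.2.1
    refine ⟨∑ j, K j / r, fun a b ξ => ?_⟩
    rw [hD]
    refine (Finset.abs_sum_le_sum_abs _ _).trans (Finset.sum_le_sum fun j _ => ?_)
    rw [hT]
    split_ifs
    · simpa using div_nonneg (hK0 j).le (Nat.cast_nonneg r)
    all_goals exact hK j _ _ _
  · choose m hm using fun j => exists_lower_bound (f j) (hf j).1.continuous (hf j).2.1
      (hf j).2.2.2.1
    intro C
    choose R hR using fun j => (hf j).2.2.2.1 (C - ∑ i ∈ Finset.univ.erase j, m i)
    refine ⟨1 + ∑ j, |R j|, fun ξ ⟨i, hi⟩ => ?_⟩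
    have hpos : 0 ≤ ∑ j, |R j| := Finset.sum_nonneg fun j _ => abs_nonneg _
    rcases Fin.eq_zero_or_eq_succ i with rfl | ⟨j, rfl⟩
    · simp at hi; linarith
    · have h1 : |R j| ≤ ∑ j, |R j| :=
        Finset.single_le_sum (f := fun j => |R j|) (fun _ _ => abs_nonneg _) (Finset.mem_univ j)
      have h2 := hR j (ξ 0) (ξ j.succ) (by linarith [le_abs_self (R j)])
      have h3 : ∑ i ∈ Finset.univ.erase j, m i ≤
          ∑ i ∈ Finset.univ.erase j, f i ![ξ 0, ξ i.succ] :=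
        Finset.sum_le_sum fun i _ => hm i _ _
      have h4 := Finset.add_sum_erase Finset.univ (fun i => f i ![ξ 0, ξ i.succ])
        (Finset.mem_univ j)
      linarith
  · intro a b hab ξ
    rw [hD]
    refine Finset.sum_nonpos fun j _ => ?_
    obtain ⟨lam, hl, hlam⟩ := (hf j).2.2.2.2
    have h01 := fun z => (hlam z).trans (neg_nonpos.2 hl.le)
    rw [hT]
    split_ifs with h1 h2 h3 h3
    · exact le_rfl
    · exact absurd (h2.trans h3.symm) hab
    · exact h01 _
    · rw [hsymm]; exact h01 _
    · push Not at h1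
      exact absurd ((h1.2 h2).trans (h1.1 h3).symm) hab
  · obtain ⟨n, rfl⟩ : ∃ n, r = n + 1 := ⟨r - 1, by omega⟩
    obtain ⟨lam, hl, hlam⟩ := (hf 0).2.2.2.2
    refine ⟨lam / 2, by linarith, fun ξ => ?_⟩
    rw [hD, Finset.sum_eq_single 0]
    · rw [hT]
      have := hlam ![ξ 0, ξ (Fin.succ 0)]
      rw [if_neg (by simp), if_pos rfl, if_neg (by simp)]
      linarith
    · intro j _ hj
      rw [hT, if_pos]
      left
      refine ⟨by simp, fun h => hj ?_⟩
      rw [← Fin.succ_zero_eq_one, Fin.succ_inj] at h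
      exact h.symm
    · simp

end

end FrenkelKontorova

namespace FrenkelKontorova

variable {r : ℕ} {S : (Fin (r + 1) → ℝ) → ℝ}

/-! The twist condition makes `S` submodular (`submodular`), so passing from `x, y` to `x ⊓ y, x ⊔
y` never raises the total action. It also gives a strong comparison principle
(`IsGlobalMinimizer.eq_of_le`): ordered global minimizers that touch coincide. Hence two minimizers
are comparable once `x ⊓ y` or `x ⊔ y` is a global minimizer.

To prove such minimality, boundary terms must be controlled. For `x` in one of the two sets, the
Birkhoff property and the rotation number keep all translates by `(n * p, n * q)` within distance 1
of `x`. They are monotone in `n`, so they converge to periodic minimizers: for `p > 0`, `u`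
describes `x` near `-∞` and `u'` describes it near `+∞`. Splicing sequences with a common limit
costs an error (`seam`) that tends to 0 as the window grows. Periodic minimizers are pairwise
comparable, as their actions over a period can be compared exactly.

If the limits of `x` and `y` are ordered the same way at both ends, `x ⊓ y` and `x ⊔ y` have these
same limits, and submodularity makes `x ⊓ y` minimal (`isGlobalMinimizer_of_same_limits`). If the
orders at the two ends are opposite, the fact that both sequences rise, or both fall, nests the
limits of one between those of the other. The outer sequence is then comparable with an inner
periodic limit (`isGlobalMinimizer_of_between`). This forces the limits at one end to coincide and
brings back the first case. -/

theorem fderiv_apply_eq_sum {n : ℕ} (F : (Fin n → ℝ) → ℝ) (ξ v : Fin n → ℝ) :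
    fderiv ℝ F ξ v = ∑ k, v k * partialDeriv k F ξ := by
  conv_lhs => rw [pi_eq_sum_univ' v, map_sum]
  refine Finset.sum_congr rfl fun k _ => ?_
  rw [map_smul, smul_eq_mul, partialDeriv]

/-! ### Monotone first derivatives and submodularity of the local energy. -/

namespace IsWeakTwistLocalEnergy

theorem differentiable (hS : IsWeakTwistLocalEnergy S) : Differentiable ℝ S :=
  hS.contDiff.differentiable (by norm_num)

theorem differentiable_partialDeriv (hS : IsWeakTwistLocalEnergy S) (k : Fin (r + 1)) :
    Differentiable ℝ (partialDeriv k S) :=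
  ((hS.contDiff.fderiv_right (m := 1) (by norm_num)).differentiable (by norm_num)).clm_apply
    (differentiable_const _)

theorem partialDeriv₂_comm (hS : IsWeakTwistLocalEnergy S) (j k : Fin (r + 1))
    (ξ : Fin (r + 1) → ℝ) : partialDeriv₂ j k S ξ = partialDeriv₂ k j S ξ := by
  have hd : DifferentiableAt ℝ (fderiv ℝ S) ξ :=
    (hS.contDiff.fderiv_right (m := 1) (by norm_num)).differentiable (by norm_num) ξ
  have hs := (hS.contDiff.contDiffAt (x := ξ)).isSymmSndFDerivAt (by simp)
  have e : ∀ u w, fderiv ℝ (fun z => fderiv ℝ S z u) ξ w = fderiv ℝ (fderiv ℝ S) ξ w u := by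
    intro u w
    rw [fderiv_clm_apply hd (differentiableAt_const u)]; simp
  simp only [partialDeriv₂, partialDeriv]
  unfold partialDeriv
  rw [e, e, hs.eq]

/-- Mean value inequality for `∂ₖ S` between comparable points that agree in the `k`-th variable. -/
theorem partialDeriv_sub_le (hS : IsWeakTwistLocalEnergy S) {k l : Fin (r + 1)} (hlk : l ≠ k)
    {c : ℝ} (hc : ∀ ζ, partialDeriv₂ l k S ζ ≤ c) {ξ η : Fin (r + 1) → ℝ} (h : ξ ≤ η)
    (hk : ξ k = η k) : partialDeriv k S η - partialDeriv k S ξ ≤ c * (η l - ξ l) := by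
  have hd : ∀ t : ℝ, HasDerivAt (fun t : ℝ => partialDeriv k S (ξ + t • (η - ξ)))
      (fderiv ℝ (partialDeriv k S) (ξ + t • (η - ξ)) (η - ξ)) t := by
    intro t
    have h1 : HasDerivAt (fun t : ℝ => ξ + t • (η - ξ)) (η - ξ) t := by
      simpa using ((hasDerivAt_id t).smul_const (η - ξ)).const_add ξ
    exact ((hS.differentiable_partialDeriv k) _).hasFDerivAt.comp_hasDerivAt t h1
  obtain ⟨t, -, ht⟩ := exists_hasDerivAt_eq_slope _ _ zero_lt_one
    (fun t _ => (hd t).continuousAt.continuousWithinAt) (fun t _ => hd t)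
  simp only [one_smul, zero_smul, add_zero, sub_zero, div_one, add_sub_cancel] at ht
  -- The `k`-th increment vanishes and all other terms are nonpositive by twist, so only the `l`-th
  -- is kept.
  rw [← ht, fderiv_apply_eq_sum, ← Finset.add_sum_erase _ _ (Finset.mem_univ l)]
  have h1 : (η - ξ) l * partialDeriv l (partialDeriv k S) (ξ + t • (η - ξ)) ≤ c * (η l - ξ l) := by
    rw [mul_comm]
    exact mul_le_mul_of_nonneg_right (hc _) (sub_nonneg.2 (h l))
  refine (add_le_add h1 (Finset.sum_nonpos fun j _ => ?_)).trans (add_zero _).le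
  by_cases hj : j = k
  · subst hj; simp [hk]
  · exact mul_nonpos_of_nonneg_of_nonpos (sub_nonneg.2 (h j)) (hS.twist_nonpos j k hj _)

theorem zero_ne_one (hS : IsWeakTwistLocalEnergy S) : (0 : Fin (r + 1)) ≠ 1 := by
  have := hS.one_le_range
  obtain ⟨n, rfl⟩ : ∃ n, r = n + 1 := ⟨r - 1, by omega⟩
  simp

theorem partialDeriv_anti (hS : IsWeakTwistLocalEnergy S) (k : Fin (r + 1))
    {ξ η : Fin (r + 1) → ℝ} (h : ξ ≤ η) (hk : ξ k = η k) :
    partialDeriv k S η ≤ partialDeriv k S ξ := by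
  obtain ⟨l, hl⟩ : ∃ l, l ≠ k := by
    by_cases h0 : k = 0
    · exact ⟨1, h0 ▸ hS.zero_ne_one.symm⟩
    · exact ⟨0, Ne.symm h0⟩
  have := hS.partialDeriv_sub_le hl (hS.twist_nonpos l k hl) h hk
  linarith

/-- Moving by `ξ - m` leads from `η` to `ξ ⊔ η` and from `m` to `ξ`. In each coordinate `k` that
moves, `m` and `η` agree, so the derivative along the upper path is at most that along the lower
one. -/
theorem submodular (hS : IsWeakTwistLocalEnergy S) (ξ η : Fin (r + 1) → ℝ) :
    S (ξ ⊓ η) + S (ξ ⊔ η) ≤ S ξ + S η := by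
  set m := ξ ⊓ η with hm
  have hd : ∀ (b : Fin (r + 1) → ℝ) (s : ℝ), HasDerivAt (fun s : ℝ => S (b + s • (ξ - m)))
      (fderiv ℝ S (b + s • (ξ - m)) (ξ - m)) s := by
    intro b s
    have h1 : HasDerivAt (fun s : ℝ => b + s • (ξ - m)) (ξ - m) s := by
      simpa using ((hasDerivAt_id s).smul_const (ξ - m)).const_add b
    exact (hS.differentiable _).hasFDerivAt.comp_hasDerivAt s h1
  have hd' := fun s => (hd η s).sub (hd m s)
  obtain ⟨s, hs, hs'⟩ := exists_hasDerivAt_eq_slope _ _ zero_lt_one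
    (fun t _ => (hd' t).continuousAt.continuousWithinAt) (fun t _ => hd' t)
  simp only [Pi.sub_apply, one_smul, zero_smul, add_zero, sub_zero, div_one, add_sub_cancel] at hs'
  have hmax : η + (ξ - m) = ξ ⊔ η := by
    ext i
    have := min_add_max (ξ i) (η i)
    simp only [hm, Pi.add_apply, Pi.sub_apply, Pi.inf_apply, Pi.sup_apply]
    linarith
  rw [hmax, fderiv_apply_eq_sum, fderiv_apply_eq_sum, ← Finset.sum_sub_distrib] at hs'
  have h0 : ∑ k, ((ξ - m) k * partialDeriv k S (η + s • (ξ - m)) -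
      (ξ - m) k * partialDeriv k S (m + s • (ξ - m))) ≤ 0 := by
    refine Finset.sum_nonpos fun k _ => ?_
    rw [← mul_sub]
    rcases le_total (ξ k) (η k) with h | h
    · simp [hm, h]
    · refine mul_nonpos_of_nonneg_of_nonpos (by simp [hm]) (sub_nonpos.2 ?_)
      refine hS.partialDeriv_anti k (fun i => ?_) ?_
      · simp [hm]
      · simp [hm, h]
  linarith

end IsWeakTwistLocalEnergy

/-! ### Actions on windows and the cost of gluing. -/

/-- The action `∑_{a ≤ i < b} S_i(x)`. -/
noncomputable def action {r : ℕ} (S : (Fin (r + 1) → ℝ) → ℝ) (a b : ℤ) (x : ℤ → ℝ) : ℝ :=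
  ∑ i ∈ Finset.Ico a b, localEnergyAt S i x

/-- The sequence equal to `u` on `(-∞, c)` and to `w` on `[c, ∞)`. -/
noncomputable def glue (c : ℤ) (u w : ℤ → ℝ) : ℤ → ℝ := fun i => if i < c then u i else w i

/-- The change of action caused by gluing `w` to `u` at `c`. -/
noncomputable def seam {r : ℕ} (S : (Fin (r + 1) → ℝ) → ℝ) (c : ℤ) (u w : ℤ → ℝ) : ℝ :=
  action S (c - r) c (glue c u w) - action S (c - r) c u

theorem localEnergyAt_congr {j : ℤ} {x y : ℤ → ℝ} (h : ∀ i, j ≤ i → i ≤ j + r → x i = y i) :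
    localEnergyAt S j x = localEnergyAt S j y := by
  unfold localEnergyAt
  congr 1
  ext m
  exact h _ (by omega) (by omega)

theorem action_congr {a b : ℤ} {x y : ℤ → ℝ} (h : ∀ i, a ≤ i → i < b + r → x i = y i) :
    action S a b x = action S a b y := by
  refine Finset.sum_congr rfl fun j hj => localEnergyAt_congr fun i h1 h2 => ?_
  rw [Finset.mem_Ico] at hj
  exact h i (by omega) (by omega)

theorem action_add {a b c : ℤ} (hab : a ≤ b) (hbc : b ≤ c) (x : ℤ → ℝ) :
    action S a b x + action S b c x = action S a c x := by
  unfold action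
  rw [← Finset.Ico_union_Ico_eq_Ico hab hbc, Finset.sum_union (Finset.Ico_disjoint_Ico_consecutive a b c)]

theorem action_sub_action_eq {a b s t : ℤ} (hsa : s ≤ a) (hab : a ≤ b) (hbt : b ≤ t) {x w : ℤ → ℝ}
    (h : ∀ i, i < a + r ∨ b ≤ i → w i = x i) :
    action S s t x - action S s t w = action S a b x - action S a b w := by
  have h1 : action S s a w = action S s a x := action_congr fun i _ h => by grind
  have h2 : action S b t w = action S b t x := action_congr fun i _ h => by grind
  rw [← action_add hsa (hab.trans hbt) x, ← action_add hab hbt x, ← action_add hsa (hab.trans hbt) w,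
    ← action_add hab hbt w]
  linarith

/-- Only sites in `[a + r, b)` may vary: these are the sites all of whose local energies are counted
in `action S a b`. -/
theorem isGlobalMinimizer_iff {x : ℤ → ℝ} : IsGlobalMinimizer S x ↔ ∀ a b : ℤ, a + r < b →
    ∀ w : ℤ → ℝ, (∀ i, i < a + r ∨ b ≤ i → w i = x i) → action S a b x ≤ action S a b w := by
  have key : ∀ (i₀ i₁ : ℤ) (y : ℤ → ℝ), segmentAction S i₀ i₁ y = action S (i₀ - r) (i₁ + 1) y := by
    intro i₀ i₁ y
    unfold segmentAction action
    congr 1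
  constructor
  · intro h a b hab w hw
    have := h (a + r) (b - 1) (by omega) (w - x) (fun i hi => by
      by_contra hi'
      exact hi (sub_eq_zero.2 (hw i (by simp only [Set.mem_Icc] at hi'; omega))))
    rwa [key, key, add_sub_cancel_right, sub_add_cancel, add_sub_cancel] at this
  · intro h i₀ i₁ hi v hv
    rw [key, key]
    refine h _ _ (by omega) _ fun i hi' => ?_
    have : v i = 0 := by
      by_contra h0
      have := hv h0
      simp only [Set.mem_Icc] at this
      omega
    simp [this]

theorem action_glue {a b c : ℤ} (hac : a ≤ c - r) (hcb : c ≤ b) (u w : ℤ → ℝ) :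
    action S a b (glue c u w) = action S a c u + action S c b w + seam S c u w := by
  have h1 : action S c b (glue c u w) = action S c b w :=
    action_congr fun i hi _ => if_neg (by omega)
  have h2 : action S a (c - r) (glue c u w) = action S a (c - r) u :=
    action_congr fun i _ hi => if_pos (by omega)
  rw [← action_add (b := c) (by omega) hcb, h1, ← action_add (b := c - r) hac (by omega), h2,
    ← action_add (a := a) (b := c - r) (c := c) hac (by omega), seam]
  ring

theorem seam_self (c : ℤ) (u : ℤ → ℝ) : seam S c u u = 0 := by
  have : glue c u u = u := by ext i; simp [glue]
  rw [seam, this, sub_self]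

theorem seam_congr {c : ℤ} {u u' w w' : ℤ → ℝ} (hu : ∀ i, c - r ≤ i → i < c + r → u i = u' i)
    (hw : ∀ i, c ≤ i → i < c + r → w i = w' i) : seam S c u w = seam S c u' w' := by
  have key : ∀ i, c - r ≤ i → i < c + r → glue c u w i = glue c u' w' i := by
    intro i h1 h2
    unfold glue
    split_ifs with h
    · exact hu i h1 h2
    · exact hw i (by omega) h2
  rw [seam, seam, action_congr key, action_congr hu]

/-- A global minimizer compared with an arbitrary sequence on `[a, b)`. -/
theorem IsGlobalMinimizer.action_le {x : ℤ → ℝ} (hx : IsGlobalMinimizer S x) {a b : ℤ}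
    (hab : a + r ≤ b) (w : ℤ → ℝ) :
    action S a b x ≤ action S a b w + seam S a x w + seam S b w x := by
  have h := isGlobalMinimizer_iff.1 hx (a - r) (b + 1) (by omega) (glue a x (glue b w x))
    (fun i hi => by unfold glue; grind)
  rw [action_glue le_rfl (by omega), action_glue (by omega) (by omega),
    ← action_add (b := a) (by omega) (by omega), ← action_add (b := b) (a := a) (by omega) (by omega)] at h
  have h1 : seam S a x (glue b w x) = seam S a x w :=
    seam_congr (fun _ _ _ => rfl) (fun i _ hi => if_pos (by omega))
  linarith

/-! ### Continuity for pointwise convergence. -/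

theorem continuous_action (a b : ℤ) (hS : Continuous S) : Continuous (action S a b) :=
  continuous_finsetSum _ fun _ _ => hS.comp (continuous_pi fun _ => continuous_apply _)

theorem continuous_glue (c : ℤ) : Continuous fun p : (ℤ → ℝ) × (ℤ → ℝ) => glue c p.1 p.2 := by
  refine continuous_pi fun i => ?_
  unfold glue
  split_ifs <;> fun_prop

/-- A seam reads finitely many entries, hence is continuous, and gluing a sequence to itself costs
nothing. -/
theorem tendsto_seam (hS : Continuous S) {f g : ℕ → ℤ → ℝ} {z : ℤ → ℝ} (hf : Tendsto f atTop (𝓝 z))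
    (hg : Tendsto g atTop (𝓝 z)) : Tendsto (fun n => seam S 0 (f n) (g n)) atTop (𝓝 0) := by
  have hc : Continuous fun p : (ℤ → ℝ) × (ℤ → ℝ) => seam S 0 p.1 p.2 :=
    ((continuous_action _ _ hS).comp (continuous_glue 0)).sub
      ((continuous_action _ _ hS).comp continuous_fst)
  have := (hc.tendsto (z, z)).comp (hf.prodMk_nhds hg)
  rwa [seam_self] at this

theorem isClosed_isGlobalMinimizer (hS : Continuous S) : IsClosed {x | IsGlobalMinimizer S x} := by
  have : {x | IsGlobalMinimizer S x} = ⋂ (i₀ : ℤ) (i₁ : ℤ) (_ : i₀ ≤ i₁) (v : ℤ → ℝ)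
      (_ : Function.support v ⊆ Set.Icc i₀ i₁),
      {x | segmentAction S i₀ i₁ x ≤ segmentAction S i₀ i₁ (x + v)} := by
    ext x; simp [IsGlobalMinimizer]
  rw [this]
  have hc : ∀ i₀ i₁ : ℤ, Continuous (segmentAction S i₀ i₁) := fun i₀ i₁ =>
    continuous_finsetSum _ fun _ _ => hS.comp (continuous_pi fun _ => continuous_apply _)
  exact isClosed_iInter fun i₀ => isClosed_iInter fun i₁ => isClosed_iInter fun _ =>
    isClosed_iInter fun v => isClosed_iInter fun _ =>
      isClosed_le (hc _ _) ((hc _ _).comp (continuous_add_const v))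

/-! ### Translations and lattice operations. -/

theorem translate_translate (k l k' l' : ℤ) (x : ℤ → ℝ) :
    translate k l (translate k' l' x) = translate (k + k') (l + l') x := by
  ext i
  simp only [translate]
  push_cast
  rw [sub_sub, add_assoc, add_comm (l' : ℝ)]

theorem translate_zero (x : ℤ → ℝ) : translate 0 0 x = x := by
  ext i; simp [translate]

theorem translate_mono (k l : ℤ) : Monotone (translate k l) := fun _ _ h i =>
  add_le_add_left (h (i - k)) _

theorem translate_inf (k l : ℤ) (x y : ℤ → ℝ) :
    translate k l (x ⊓ y) = translate k l x ⊓ translate k l y := by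
  ext i; exact (min_add_add_right _ _ _).symm

theorem translate_sup (k l : ℤ) (x y : ℤ → ℝ) :
    translate k l (x ⊔ y) = translate k l x ⊔ translate k l y := by
  ext i; exact (max_add_add_right _ _ _).symm

theorem continuous_translate (k l : ℤ) : Continuous (translate k l) :=
  continuous_pi fun i => (continuous_apply (i - k)).add_const _

theorem translate_mul_eq_self {p q : ℤ} {x : ℤ → ℝ} (h : translate p q x = x) (n : ℤ) :
    translate (n * p) (n * q) x = x := by
  induction n using Int.induction_on with
  | zero => simp [translate_zero]
  | succ n ih =>
    rw [add_mul, add_mul, one_mul, one_mul, ← translate_translate, h, ih]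
  | pred n ih =>
    conv_lhs => rw [← h]
    rw [translate_translate, sub_mul, sub_mul, one_mul, one_mul, sub_add_cancel, sub_add_cancel, ih]

theorem localEnergyAt_translate (hp : ∀ ξ, S (fun i => ξ i + 1) = S ξ) (j k l : ℤ) (x : ℤ → ℝ) :
    localEnergyAt S (j + k) (translate k l x) = localEnergyAt S j x := by
  have key : ∀ (n : ℕ) (ξ : Fin (r + 1) → ℝ), S (fun i => ξ i + n) = S ξ := by
    intro n
    induction n with
    | zero => simp
    | succ n ih => intro ξ; rw [← ih ξ, ← hp fun i => ξ i + n]; push_cast; simp only [add_assoc]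
  have key' : ∀ (n : ℤ) (ξ : Fin (r + 1) → ℝ), S (fun i => ξ i + n) = S ξ := by
    intro n ξ
    obtain ⟨n, rfl | rfl⟩ := n.eq_nat_or_neg
    · exact_mod_cast key n ξ
    · rw [← key n]; simp
  rw [localEnergyAt, localEnergyAt, ← key' l fun m => x (j + (m : ℕ))]
  simp only [translate]
  congr 1
  ext m
  congr 2
  ring

theorem action_translate (hp : ∀ ξ, S (fun i => ξ i + 1) = S ξ) (a b k l : ℤ) (x : ℤ → ℝ) :
    action S (a + k) (b + k) (translate k l x) = action S a b x := by
  unfold action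
  rw [← Finset.map_add_right_Ico, Finset.sum_map]
  exact Finset.sum_congr rfl fun j _ => localEnergyAt_translate hp _ _ _ _

/-- Carries seams at moving positions to site 0, where `tendsto_seam` applies; the vertical shift
`l` is free. -/
theorem seam_eq_seam_zero (hp : ∀ ξ, S (fun i => ξ i + 1) = S ξ) (c l : ℤ) (u w : ℤ → ℝ) :
    seam S c u w = seam S 0 (translate (-c) l u) (translate (-c) l w) := by
  have h : glue 0 (translate (-c) l u) (translate (-c) l w) = translate (-c) l (glue c u w) := by
    ext i
    simp only [glue, translate]
    by_cases hi : i < 0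
    · rw [if_pos hi, if_pos (by omega)]
    · rw [if_neg hi, if_neg (by omega)]
  rw [seam, seam, h, ← action_translate hp (c - r) c (-c) l, ← action_translate hp (c - r) c (-c) l]
  congr 2 <;> ring

theorem action_inf_add_action_sup_le (hS : ∀ ξ η, S (ξ ⊓ η) + S (ξ ⊔ η) ≤ S ξ + S η) (a b : ℤ)
    (x y : ℤ → ℝ) : action S a b (x ⊓ y) + action S a b (x ⊔ y) ≤ action S a b x + action S a b y := by
  unfold action
  rw [← Finset.sum_add_distrib, ← Finset.sum_add_distrib]
  exact Finset.sum_le_sum fun j _ => hS _ _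

/-! ### Stationarity and strong comparison. -/

theorem window_single (i : ℤ) (m : Fin (r + 1)) :
    (fun n : Fin (r + 1) => (Pi.single i 1 : ℤ → ℝ) (i - (m : ℕ) + (n : ℕ))) = Pi.single m 1 := by
  ext n
  by_cases h : n = m
  · subst h; simp
  · rw [Pi.single_eq_of_ne h, Pi.single_eq_of_ne]
    have : (n : ℕ) ≠ m := fun h' => h (Fin.ext h')
    omega

/-- A global minimizer is stationary. -/
theorem IsGlobalMinimizer.sum_partialDeriv_eq_zero (hS : Differentiable ℝ S) {x : ℤ → ℝ}
    (hx : IsGlobalMinimizer S x) (i : ℤ) :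
    ∑ m : Fin (r + 1), partialDeriv m S (fun n => x (i - (m : ℕ) + (n : ℕ))) = 0 := by
  have hmap : ∀ f : ℤ → ℝ, ∑ j ∈ Finset.Icc (i - r) i, f j = ∑ m : Fin (r + 1), f (i - (m : ℕ)) := by
    intro f
    refine (Finset.sum_bij (fun (m : Fin (r + 1)) _ => i - (m : ℕ)) ?_ ?_ ?_ ?_).symm
    · intro m _
      have := m.2
      simp only [Finset.mem_Icc]; omega
    · intro m _ n _ h
      exact Fin.ext (by omega)
    · intro j hj
      rw [Finset.mem_Icc] at hj
      exact ⟨⟨(i - j).toNat, by omega⟩, Finset.mem_univ _, by simp only; omega⟩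
    · intro m _; rfl
  have hd : HasDerivAt (fun t : ℝ => segmentAction S i i (x + t • (Pi.single i 1 : ℤ → ℝ)))
      (∑ m : Fin (r + 1), partialDeriv m S (fun n => x (i - (m : ℕ) + (n : ℕ)))) 0 := by
    simp only [segmentAction, hmap]
    refine HasDerivAt.fun_sum fun m _ => ?_
    have h1 : HasDerivAt (fun t : ℝ => (fun n : Fin (r + 1) => x (i - (m : ℕ) + (n : ℕ))) +
        t • (Pi.single m 1 : Fin (r + 1) → ℝ)) (Pi.single m 1) 0 := by
      simpa using ((hasDerivAt_id (0 : ℝ)).smul_const (Pi.single m 1 : Fin (r + 1) → ℝ)).const_add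
        (fun n : Fin (r + 1) => x (i - (m : ℕ) + (n : ℕ)))
    have h2 := (hS _).hasFDerivAt.comp_hasDerivAt 0 h1
    simp only [zero_smul, add_zero] at h2
    refine h2.congr_of_eventuallyEq (Eventually.of_forall fun t => ?_)
    simp only [localEnergyAt, Function.comp, ← window_single i m]
    rfl
  refine IsLocalMin.hasDerivAt_eq_zero (Eventually.of_forall fun t => ?_) hd
  simp only [zero_smul, add_zero]
  refine hx i i le_rfl _ fun j hj => ?_
  by_contra h
  rw [Set.Icc_self, Set.mem_singleton_iff] at h
  exact hj (by simp [h])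

/-- Strong comparison principle. -/
theorem IsGlobalMinimizer.eq_of_le (hS : IsWeakTwistLocalEnergy S) {x y : ℤ → ℝ}
    (hx : IsGlobalMinimizer S x) (hy : IsGlobalMinimizer S y) (h : x ≤ y) {i : ℤ} (hi : x i = y i) :
    x = y := by
  obtain ⟨lam, hlam, hneg⟩ := hS.twist_neg
  have step : ∀ i, x i = y i → x (i + 1) = y (i + 1) ∧ x (i - 1) = y (i - 1) := by
    intro i hi
    have hk : ∀ m : Fin (r + 1), x (i - (m : ℕ) + (m : ℕ)) = y (i - (m : ℕ) + (m : ℕ)) := by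
      intro m; rwa [sub_add_cancel]
    have hle : ∀ m : Fin (r + 1), (fun n : Fin (r + 1) => x (i - (m : ℕ) + (n : ℕ))) ≤
        fun n : Fin (r + 1) => y (i - (m : ℕ) + (n : ℕ)) := fun m n => h _
    -- Both stationarity sums vanish and are ordered termwise, so they agree termwise. The terms `m
    -- = 0` and `m = 1` then control the neighbours `i + 1` and `i - 1`.
    have heq := (Finset.sum_eq_sum_iff_of_le fun m _ => hS.partialDeriv_anti m (hle m) (hk m)).1
      ((hy.sum_partialDeriv_eq_zero hS.differentiable i).trans
        (hx.sum_partialDeriv_eq_zero hS.differentiable i).symm)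
    have h1 := hS.partialDeriv_sub_le hS.zero_ne_one.symm (c := -lam)
      (fun ζ => hS.partialDeriv₂_comm 0 1 ζ ▸ (hneg ζ).le) (hle 0) (hk 0)
    have h2 := hS.partialDeriv_sub_le hS.zero_ne_one (c := -lam) (fun ζ => (hneg ζ).le) (hle 1) (hk 1)
    rw [heq 0 (Finset.mem_univ _), sub_self] at h1
    rw [heq 1 (Finset.mem_univ _), sub_self] at h2
    have e : ((1 : Fin (r + 1)) : ℕ) = 1 := by
      have := hS.one_le_range
      obtain ⟨n, rfl⟩ : ∃ n, r = n + 1 := ⟨r - 1, by omega⟩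
      simp
    simp only [e, Fin.val_zero, Nat.cast_zero, Nat.cast_one, sub_zero, add_zero] at h1 h2
    have h3 := h (i + 1)
    have h4 := h (i - 1)
    constructor <;> nlinarith
  ext j
  induction j using Int.inductionOn' (b := i) with
  | zero => exact hi
  | succ k _ ih => exact (step k ih).1
  | pred k _ ih => exact (step k ih).2

/-- At site 0 the infimum touches the smaller of the two sequences, and so equals it by strong
comparison. -/
theorem le_or_le_of_isGlobalMinimizer_inf (hS : IsWeakTwistLocalEnergy S) {x y : ℤ → ℝ}
    (hx : IsGlobalMinimizer S x) (hy : IsGlobalMinimizer S y) (h : IsGlobalMinimizer S (x ⊓ y)) :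
    x ≤ y ∨ y ≤ x := by
  rcases le_total (x 0) (y 0) with h0 | h0
  · exact Or.inl (inf_eq_left.1 (h.eq_of_le hS hx inf_le_left (i := 0) (by simp [h0])))
  · exact Or.inr (inf_eq_right.1 (h.eq_of_le hS hy inf_le_right (i := 0) (by simp [h0])))

theorem le_or_le_of_isGlobalMinimizer_sup (hS : IsWeakTwistLocalEnergy S) {x y : ℤ → ℝ}
    (hx : IsGlobalMinimizer S x) (hy : IsGlobalMinimizer S y) (h : IsGlobalMinimizer S (x ⊔ y)) :
    x ≤ y ∨ y ≤ x := by
  rcases le_total (x 0) (y 0) with h0 | h0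
  · exact Or.inl (sup_eq_right.1 (hy.eq_of_le hS h le_sup_right (i := 0) (by simp [h0])).symm)
  · exact Or.inr (sup_eq_left.1 (hx.eq_of_le hS h le_sup_left (i := 0) (by simp [h0])).symm)

/-! Periodic minimizers. -/

theorem action_periodic (hper : ∀ ξ, S (fun i => ξ i + 1) = S ξ) {p q : ℤ} (hp : 0 ≤ p)
    {w : ℤ → ℝ} (hw : translate p q w = w) (a : ℤ) (n : ℕ) :
    action S a (a + n * p) w = n * action S a (a + p) w := by
  induction n with
  | zero => simp [action]
  | succ n ih =>
    have h1 : action S (a + n * p) (a + n * p + p) w = action S a (a + p) w := by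
      have := action_translate hper a (a + p) (n * p) (n * q) w
      rwa [translate_mul_eq_self hw, add_right_comm] at this
    have h2 := action_add (S := S) (a := a) (b := a + n * p) (c := a + n * p + p)
      (by nlinarith) (by omega) w
    rw [h1, ih] at h2
    push_cast
    rw [add_one_mul, ← add_assoc, ← h2]
    ring

theorem seam_periodic (hper : ∀ ξ, S (fun i => ξ i + 1) = S ξ) {p q : ℤ} {u w : ℤ → ℝ}
    (hu : translate p q u = u) (hw : translate p q w = w) (a n : ℤ) :
    seam S (a + n * p) u w = seam S a u w := by
  have key : ∀ v : ℤ → ℝ, translate p q v = v →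
      translate (-(a + n * p)) (-(n * q)) v = translate (-a) 0 v := by
    intro v hv
    conv_rhs => rw [← translate_mul_eq_self hv (-n), translate_translate]
    congr 1 <;> ring
  rw [seam_eq_seam_zero hper (a + n * p) (-(n * q)), seam_eq_seam_zero hper a 0, key u hu, key w hw]

/-- A deficit per period would accumulate linearly over many periods, while the two seams have a
fixed cost. -/
theorem IsGlobalMinimizer.action_le_of_periodic (hper : ∀ ξ, S (fun i => ξ i + 1) = S ξ) {p q : ℤ}
    (hp : 0 < p) {x w : ℤ → ℝ} (hx : IsGlobalMinimizer S x) (hxp : translate p q x = x)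
    (hwp : translate p q w = w) (a : ℤ) : action S a (a + p) x ≤ action S a (a + p) w := by
  by_contra! h
  obtain ⟨n, hn⟩ := exists_nat_gt ((seam S a x w + seam S a w x) /
    (action S a (a + p) x - action S a (a + p) w))
  rw [div_lt_iff₀ (sub_pos.2 h)] at hn
  -- The `r` extra periods make the window at least `r` long.
  have h1 := hx.action_le (a := a) (b := a + (n + r : ℕ) * p) (by push_cast; nlinarith) w
  rw [action_periodic hper hp.le hxp, action_periodic hper hp.le hwp, seam_periodic hper hwp hxp] at h1
  push_cast at h1
  have h2 : (0 : ℝ) ≤ r * (action S a (a + p) x - action S a (a + p) w) :=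
    mul_nonneg (Nat.cast_nonneg r) (sub_pos.2 h).le
  nlinarith

/-- A local competitor becomes periodic for a period long enough to contain it. Over that period `x`
loses to this extension, `y` loses to `x ⊔ y`, and submodularity cancels the suprema. -/
theorem isGlobalMinimizer_inf_of_periodic (hper : ∀ ξ, S (fun i => ξ i + 1) = S ξ)
    (hsub : ∀ ξ η, S (ξ ⊓ η) + S (ξ ⊔ η) ≤ S ξ + S η) {p q : ℤ} (hp : 0 < p) {x y : ℤ → ℝ}
    (hx : IsGlobalMinimizer S x) (hy : IsGlobalMinimizer S y) (hxp : translate p q x = x)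
    (hyp : translate p q y = y) : IsGlobalMinimizer S (x ⊓ y) := by
  refine isGlobalMinimizer_iff.2 fun a b hab w hw => ?_
  set P := (b - a) * p with hP
  set Q := (b - a) * q with hQ
  have hP1 : b - a ≤ P := by nlinarith
  have hP0 : 0 < P := by omega
  have hxP : translate P Q x = x := translate_mul_eq_self hxp _
  have hyP : translate P Q y = y := translate_mul_eq_self hyp _
  have hmP : translate P Q (x ⊓ y) = x ⊓ y := by rw [translate_inf, hxP, hyP]
  have hMP : translate P Q (x ⊔ y) = x ⊔ y := by rw [translate_sup, hxP, hyP]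
  -- The periodic extension of `w` from `[a, a + P)`.
  set u : ℤ → ℝ := fun i => w (a + (i - a) % P) + ((i - a) / P * Q : ℤ) with hu
  have huP : translate P Q u = u := by
    ext i
    have h1 : i - P - a = i - a + P * (-1) := by ring
    simp only [translate, hu, h1, Int.add_mul_emod_self_left, Int.add_mul_ediv_left _ _ hP0.ne']
    push_cast
    ring
  have huw : action S a (a + P) u = action S a (a + P) w := by
    refine action_congr fun i h1 h2 => ?_
    rcases lt_or_ge i (a + P) with h | h
    · simp only [hu]
      rw [Int.emod_eq_of_lt (by omega) (by omega), Int.ediv_eq_zero_of_lt (by omega) (by omega)]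
      simp
    · have e : i - a = i - P - a + P * 1 := by ring
      simp only [hu]
      rw [e, Int.add_mul_emod_self_left, Int.add_mul_ediv_left _ _ hP0.ne',
        Int.emod_eq_of_lt (by omega) (by omega), Int.ediv_eq_zero_of_lt (by omega) (by omega),
        hw i (by omega), hw _ (by omega)]
      have h3 := congrFun hmP i
      simp only [translate] at h3
      rw [← h3, ← add_sub_assoc, add_sub_cancel_left]
      simp
  have h1 := hx.action_le_of_periodic hper hP0 hxP huP a
  have h2 := hy.action_le_of_periodic hper hP0 hyP hMP a
  have h3 := action_inf_add_action_sup_le hsub a (a + P) x y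
  have h4 := action_sub_action_eq (S := S) le_rfl (by omega : a ≤ b) (by omega : b ≤ a + P) hw
  linarith

/-! Sequences asymptotic to periodic minimizers. -/

theorem tendsto_translate_of_eq {p q : ℤ} (hp : p ≠ 0) {a b : ℤ} {x w u : ℤ → ℝ}
    (h : ∀ i, i < a ∨ b ≤ i → w i = x i)
    (hx : Tendsto (fun n : ℕ => translate (n * p) (n * q) x) atTop (𝓝 u)) :
    Tendsto (fun n : ℕ => translate (n * p) (n * q) w) atTop (𝓝 u) := by
  rw [tendsto_pi_nhds] at hx ⊢
  intro i
  refine (hx i).congr' ?_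
  filter_upwards [eventually_ge_atTop (|i - a| + |i - b| + 1).toNat] with n hn
  simp only [translate]
  rw [h]
  have h1 := neg_abs_le (i - a)
  have h2 := le_abs_self (i - b)
  have h3 : |i - a| + |i - b| + 1 ≤ n := by omega
  have h4 := le_abs_self (i - a)
  have h5 := neg_abs_le (i - b)
  rcases lt_or_gt_of_ne hp with h | h
  · right
    have : n * p ≤ -n := by nlinarith
    omega
  · left
    have : n ≤ n * p := by nlinarith
    omega

/-- Minimality of a sequence with the action of a minimizer up to a small error. -/
theorem isGlobalMinimizer_of_tendsto {p : ℤ} (hp : 0 < p) {x : ℤ → ℝ}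
    (h : ∀ (a b : ℤ) (w : ℤ → ℝ), (∀ i, i < a + r ∨ b ≤ i → w i = x i) → ∃ ε : ℕ → ℝ,
      Tendsto ε atTop (𝓝 0) ∧ ∀ᶠ n : ℕ in atTop,
        action S (-(n * p)) (n * p) x ≤ action S (-(n * p)) (n * p) w + ε n) :
    IsGlobalMinimizer S x := by
  refine isGlobalMinimizer_iff.2 fun a b hab w hw => ?_
  obtain ⟨ε, hε, hle⟩ := h a b w hw
  refine sub_nonpos.1 (ge_of_tendsto hε ?_)
  filter_upwards [hle, eventually_ge_atTop (|a| + |b|).toNat] with n hn hn'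
  have h1 := neg_abs_le a
  have h2 := le_abs_self b
  have h3 : |a| + |b| ≤ n * p := by
    have : |a| + |b| ≤ n := by omega
    nlinarith
  have h4 := abs_nonneg a
  have h5 := abs_nonneg b
  rw [← action_sub_action_eq (s := -(n * p)) (t := n * p) (by omega) (by omega) (by omega) hw]
  linarith

/-- Up to vanishing seams, `x` costs at most `w` and `y` costs at most `b`; subtracting `b` from
`hab` bounds the action of `a` by that of `w`. -/
theorem isGlobalMinimizer_of_same_limits (hc : Continuous S)
    (hper : ∀ ξ, S (fun i => ξ i + 1) = S ξ) {p q : ℤ} (hp : 0 < p) {x y a b u v u' v' : ℤ → ℝ}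
    (hx : IsGlobalMinimizer S x) (hy : IsGlobalMinimizer S y)
    (hab : ∀ s t, action S s t a + action S s t b ≤ action S s t x + action S s t y)
    (hxu : Tendsto (fun n : ℕ => translate (n * p) (n * q) x) atTop (𝓝 u))
    (hau : Tendsto (fun n : ℕ => translate (n * p) (n * q) a) atTop (𝓝 u))
    (hyv : Tendsto (fun n : ℕ => translate (n * p) (n * q) y) atTop (𝓝 v))
    (hbv : Tendsto (fun n : ℕ => translate (n * p) (n * q) b) atTop (𝓝 v))
    (hxu' : Tendsto (fun n : ℕ => translate (n * -p) (n * -q) x) atTop (𝓝 u'))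
    (hau' : Tendsto (fun n : ℕ => translate (n * -p) (n * -q) a) atTop (𝓝 u'))
    (hyv' : Tendsto (fun n : ℕ => translate (n * -p) (n * -q) y) atTop (𝓝 v'))
    (hbv' : Tendsto (fun n : ℕ => translate (n * -p) (n * -q) b) atTop (𝓝 v')) :
    IsGlobalMinimizer S a := by
  refine isGlobalMinimizer_of_tendsto hp fun s t w hw => ?_
  have hwu := tendsto_translate_of_eq hp.ne' hw hau
  have hwu' := tendsto_translate_of_eq (neg_ne_zero.2 hp.ne') hw hau'
  have hE := ((tendsto_seam hc hxu hwu).add (tendsto_seam hc hwu' hxu')).add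
    ((tendsto_seam hc hyv hbv).add (tendsto_seam hc hbv' hyv'))
  simp only [add_zero] at hE
  refine ⟨_, hE, ?_⟩
  filter_upwards [eventually_ge_atTop r] with n hn
  have hnp : -(n * p) + r ≤ n * p := by
    have : (r : ℤ) ≤ n := by omega
    nlinarith
  have h1 := hx.action_le hnp w
  have h2 := hy.action_le hnp b
  have h3 := hab (-(n * p)) (n * p)
  rw [seam_eq_seam_zero hper (n * p) (-(n * q)), seam_eq_seam_zero hper (-(n * p)) (n * q),
    neg_neg] at h1 h2
  simp only [mul_neg]
  linarith

/-- Here `a` runs from `u` to `z` and `b` from `z` to `u'`. Following `a` and then a shifted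
competitor of `b` gives a competitor for `y`, on a window twice as long. The surplus half of `y`
costs asymptotically at least as much as `z`, so `hab` applies. -/
theorem isGlobalMinimizer_of_between (hc : Continuous S)
    (hper : ∀ ξ, S (fun i => ξ i + 1) = S ξ) {p q : ℤ} (hp : 0 < p) {y z a b u u' : ℤ → ℝ}
    (hy : IsGlobalMinimizer S y) (hz : IsGlobalMinimizer S z) (hu' : IsGlobalMinimizer S u')
    (hzp : translate p q z = z) (hup' : translate p q u' = u')
    (hab : ∀ s t, action S s t a + action S s t b ≤ action S s t y + action S s t z)
    (hyu : Tendsto (fun n : ℕ => translate (n * p) (n * q) y) atTop (𝓝 u))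
    (hau : Tendsto (fun n : ℕ => translate (n * p) (n * q) a) atTop (𝓝 u))
    (hbz : Tendsto (fun n : ℕ => translate (n * p) (n * q) b) atTop (𝓝 z))
    (hyu' : Tendsto (fun n : ℕ => translate (n * -p) (n * -q) y) atTop (𝓝 u'))
    (haz : Tendsto (fun n : ℕ => translate (n * -p) (n * -q) a) atTop (𝓝 z))
    (hbu' : Tendsto (fun n : ℕ => translate (n * -p) (n * -q) b) atTop (𝓝 u')) :
    IsGlobalMinimizer S b := by
  refine isGlobalMinimizer_of_tendsto hp fun s t w hw => ?_
  have hwz := tendsto_translate_of_eq hp.ne' hw hbz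
  have hwu' := tendsto_translate_of_eq (neg_ne_zero.2 hp.ne') hw hbu'
  have hyu3 : Tendsto (fun n : ℕ => translate ((3 * n : ℕ) * -p) ((3 * n : ℕ) * -q) y) atTop (𝓝 u') :=
    hyu'.comp (tendsto_atTop_mono (fun n => (by omega : n ≤ 3 * n)) tendsto_id)
  have hE := (((tendsto_seam hc hyu hau).add (tendsto_seam hc hwu' hyu3)).add
    (tendsto_seam hc haz hwz)).add ((tendsto_seam hc tendsto_const_nhds hyu').add
      (tendsto_seam hc hyu3 tendsto_const_nhds))
  simp only [add_zero] at hE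
  refine ⟨_, hE, ?_⟩
  filter_upwards [eventually_ge_atTop r] with n hn
  have hnp : (r : ℤ) ≤ n * p := by
    have : (r : ℤ) ≤ n := by omega
    nlinarith
  obtain ⟨N, hN⟩ : ∃ N : ℤ, N = n * p := ⟨_, rfl⟩
  obtain ⟨R, hR⟩ : ∃ R : ℤ, R = n * q := ⟨_, rfl⟩
  simp only [Nat.cast_mul, Nat.cast_ofNat, mul_neg, mul_assoc, ← hN, ← hR] at hnp ⊢
  have hzN : translate (2 * N) (2 * R) z = z := by
    rw [hN, hR, ← mul_assoc, ← mul_assoc, translate_mul_eq_self hzp]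
  have huN : ∀ k : ℤ, translate (k * N) (k * R) u' = u' := by
    intro k
    rw [hN, hR, ← mul_assoc, ← mul_assoc, translate_mul_eq_self hup']
  -- The shift places the end of `w` that is close to `z` at site `N`, where `a` has come close to
  -- `z`.
  set w' := translate (2 * N) (2 * R) w with hw'
  set g := glue N a w' with hg
  -- the competitor `g` for `y`
  have e1 := hy.action_le (a := -N) (b := 3 * N) (by omega) g
  have e2 : action S (-N) (3 * N) g = action S (-N) N a + action S N (3 * N) w' + seam S N a w' :=
    action_glue (by omega) (by omega) _ _
  have e3 : action S N (3 * N) w' = action S (-N) N w := by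
    rw [← action_translate hper (-N) N (2 * N) (2 * R)]
    congr 1 <;> ring
  have e4 : seam S (-N) y g = seam S (-N) y a :=
    seam_congr (fun _ _ _ => rfl) fun i _ hi => if_pos (by omega)
  have e5 : seam S (3 * N) g y = seam S (3 * N) w' y :=
    seam_congr (fun i hi _ => if_neg (by omega)) fun _ _ _ => rfl
  -- lower bound for the action of `y` on `[N, 3 N)`
  have e6 := hu'.action_le (a := N) (b := 3 * N) (by omega) y
  have e7 : action S (-N) N z ≤ action S N (3 * N) u' := by
    rcases eq_or_lt_of_le (show 0 ≤ N by omega) with h0 | h0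
    · simp [← h0, action]
    have h1 := hz.action_le_of_periodic hper (by omega) hzN (huN 2) (-N)
    rw [← action_translate hper _ _ (2 * N) (2 * R) u', huN 2] at h1
    convert h1 using 2 <;> ring
  have e8 := action_add (S := S) (a := -N) (b := N) (c := 3 * N) (by omega) (by omega) y
  have e9 := hab (-N) N
  have s1 : seam S (-N) y a = seam S 0 (translate N R y) (translate N R a) := by
    rw [seam_eq_seam_zero hper (-N) R, neg_neg]
  have s2 : seam S (3 * N) w' y =
      seam S 0 (translate (-N) (-R) w) (translate (-(3 * N)) (-(3 * R)) y) := by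
    rw [seam_eq_seam_zero hper (3 * N) (-(3 * R)), hw', translate_translate]
    congr 2 <;> ring
  have s3 : seam S N a w' = seam S 0 (translate (-N) (-R) a) (translate N R w) := by
    rw [seam_eq_seam_zero hper N (-R), hw', translate_translate]
    congr 2 <;> ring
  have s4 : seam S N u' y = seam S 0 u' (translate (-N) (-R) y) := by
    rw [seam_eq_seam_zero hper N (-R)]
    congr 1
    simpa using huN (-1)
  have s5 : seam S (3 * N) y u' = seam S 0 (translate (-(3 * N)) (-(3 * R)) y) u' := by
    rw [seam_eq_seam_zero hper (3 * N) (-(3 * R))]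
    congr 1
    simpa using huN (-3)
  linarith

theorem translate_eq_self_of_tendsto {p q : ℤ} {x u : ℤ → ℝ}
    (hx : Tendsto (fun n : ℕ => translate (n * p) (n * q) x) atTop (𝓝 u)) : translate p q u = u := by
  refine tendsto_nhds_unique (((continuous_translate p q).tendsto u).comp hx) ?_
  refine (hx.comp (tendsto_add_atTop_nat 1)).congr fun n => ?_
  simp only [Function.comp, translate_translate]
  congr 1 <;> push_cast <;> ring

theorem translate_eq_self_of_neg {p q : ℤ} {u : ℤ → ℝ} (h : translate (-p) (-q) u = u) :
    translate p q u = u := by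
  conv_lhs => rw [← h, translate_translate]
  simp [translate_zero]

theorem isGlobalMinimizer_translate (hper : ∀ ξ, S (fun i => ξ i + 1) = S ξ) {x : ℤ → ℝ}
    (hx : IsGlobalMinimizer S x) (k l : ℤ) : IsGlobalMinimizer S (translate k l x) := by
  refine isGlobalMinimizer_iff.2 fun a b hab w hw => ?_
  have h := isGlobalMinimizer_iff.1 hx (a - k) (b - k) (by omega) (translate (-k) (-l) w)
    (fun i hi => by
      simp only [translate]
      rw [hw _ (by omega)]
      simp [translate])
  rw [← action_translate hper (a - k) (b - k) k l, ← action_translate hper (a - k) (b - k) k l,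
    translate_translate] at h
  simpa [translate_zero] using h

theorem isGlobalMinimizer_of_tendsto_translate (hc : Continuous S)
    (hper : ∀ ξ, S (fun i => ξ i + 1) = S ξ) {p q : ℤ} {x u : ℤ → ℝ} (hx : IsGlobalMinimizer S x)
    (hu : Tendsto (fun n : ℕ => translate (n * p) (n * q) x) atTop (𝓝 u)) :
    IsGlobalMinimizer S u :=
  (isClosed_isGlobalMinimizer hc).mem_of_tendsto hu
    (Eventually.of_forall fun _ => isGlobalMinimizer_translate hper hx _ _)

/-! Existence of limits. -/

theorem le_translate_mul {k l : ℤ} {x : ℤ → ℝ} (h : x ≤ translate k l x) (j : ℕ) :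
    x ≤ translate (j * k) (j * l) x := by
  induction j with
  | zero => simp [translate_zero]
  | succ j ih =>
    refine ih.trans ((translate_mono _ _ h).trans_eq ?_)
    rw [translate_translate]
    congr 1 <;> push_cast <;> ring

/-- Were the drift larger than 1, the Birkhoff property would give `x ≤ translate (n * p) (n * q -
1) x`; iterating and averaging contradicts the rotation number, in the form `0 ≤ -1`. -/
theorem translate_mul_le {p q : ℤ} (hp : p ≠ 0) {x : ℤ → ℝ} (hb : IsBirkhoff x)
    (hr : HasRotationNumber x ((q : ℝ) / p)) (n : ℤ) (i : ℤ) :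
    translate (n * p) (n * q) x i ≤ x i + 1 := by
  rcases eq_or_ne n 0 with rfl | hn
  · simp [translate_zero]
  have key : translate (n * p) (n * q - 1) x ≤ x := by
    refine (hb _ _).resolve_right fun h => ?_
    have hk : n * p ≠ 0 := mul_ne_zero hn hp
    -- The cofinite filter treats both signs of `n * p` at once.
    have hr' : Tendsto (fun m : ℤ => x m / m) cofinite (𝓝 ((q : ℝ) / p)) := by
      rw [Int.cofinite_eq]
      exact hr.2.sup hr.1
    have hinj : Function.Injective fun j : ℕ => -(j * (n * p) : ℤ) := by
      intro a b hab
      simpa [hk, hn, hp] using hab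
    have h1 := (hr'.comp (Nat.cofinite_eq_atTop ▸ hinj.tendsto_cofinite)).mul_const (-(n * p : ℝ))
    have h2 : Tendsto (fun j : ℕ => x 0 / j) atTop (𝓝 0) := tendsto_const_div_atTop_nhds_zero_nat _
    have h3 : (0 : ℝ) ≤ q / p * -(n * p) + (n * q - 1) := by
      refine le_of_tendsto_of_tendsto h2 (h1.add_const _) ?_
      filter_upwards [eventually_gt_atTop 0] with j hj
      have h4 := le_translate_mul h j 0
      simp only [translate, zero_sub] at h4
      have hj' : (0 : ℝ) < j := Nat.cast_pos.2 hj
      have hn' : (n : ℝ) ≠ 0 := Int.cast_ne_zero.2 hn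
      have hp' : (p : ℝ) ≠ 0 := Int.cast_ne_zero.2 hp
      simp only [Function.comp]
      push_cast at h4 ⊢
      rw [div_mul_eq_mul_div, mul_div_assoc, show -((n : ℝ) * p) / -(j * (n * p)) = 1 / j by
        field_simp, mul_one_div, div_add' _ _ _ hj'.ne', div_le_div_iff_of_pos_right hj']
      linarith
    have hp' : (p : ℝ) ≠ 0 := Int.cast_ne_zero.2 hp
    have e : (q : ℝ) / p * -(n * p) + (n * q - 1) = -1 := by field_simp; ring
    linarith
  have := key i
  simp only [translate] at this ⊢
  push_cast at this ⊢
  linarith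

theorem le_translate_mul_add_one {p q : ℤ} (hp : p ≠ 0) {x : ℤ → ℝ} (hb : IsBirkhoff x)
    (hr : HasRotationNumber x ((q : ℝ) / p)) (n : ℤ) (i : ℤ) :
    x i ≤ translate (n * p) (n * q) x i + 1 := by
  have := translate_mul_le hp hb hr (-n) (i - n * p)
  simp only [translate] at this ⊢
  rw [neg_mul, sub_neg_eq_add, sub_add_cancel] at this
  push_cast at this ⊢
  linarith

theorem monotone_translate_mul {p q : ℤ} {x : ℤ → ℝ} (h : x ≤ translate p q x) :
    Monotone fun n : ℤ => translate (n * p) (n * q) x := by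
  refine monotone_int_of_le_succ fun n => ?_
  refine (translate_mono (n * p) (n * q) h).trans_eq ?_
  rw [translate_translate]
  congr 1 <;> ring

theorem exists_tendsto_translate_mul {p q : ℤ} {x : ℤ → ℝ} (h : x ≤ translate p q x)
    (h1 : ∀ n i : ℤ, translate (n * p) (n * q) x i ≤ x i + 1)
    (h2 : ∀ n i : ℤ, x i ≤ translate (n * p) (n * q) x i + 1) :
    ∃ u u' : ℤ → ℝ, Tendsto (fun n : ℕ => translate (n * p) (n * q) x) atTop (𝓝 u) ∧
      Tendsto (fun n : ℕ => translate (n * -p) (n * -q) x) atTop (𝓝 u') ∧ u' ≤ u := by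
  have hm := monotone_translate_mul h
  have hu := fun i => tendsto_atTop_ciSup (f := fun n : ℕ => translate (n * p) (n * q) x i)
    (fun a b hab => hm (Nat.cast_le.2 hab) i) ⟨x i + 1, by rintro _ ⟨n, rfl⟩; exact h1 n i⟩
  have hu' := fun i => tendsto_atTop_ciInf (f := fun n : ℕ => translate (-n * p) (-n * q) x i)
    (fun a b hab => hm (neg_le_neg (Nat.cast_le.2 hab)) i)
    ⟨x i - 1, by rintro _ ⟨n, rfl⟩; linarith [h2 (-n) i]⟩
  refine ⟨_, _, tendsto_pi_nhds.2 hu, ?_, fun i => le_of_tendsto_of_tendsto (hu' i) (hu i) ?_⟩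
  · simp only [← neg_mul_comm]
    exact tendsto_pi_nhds.2 hu'
  · exact Eventually.of_forall fun n => hm (by omega : -(n : ℤ) ≤ n) i

/-! Comparison. -/

theorem tendsto_translate_mul_inf {p q : ℤ} {x y u v : ℤ → ℝ}
    (hx : Tendsto (fun n : ℕ => translate (n * p) (n * q) x) atTop (𝓝 u))
    (hy : Tendsto (fun n : ℕ => translate (n * p) (n * q) y) atTop (𝓝 v)) :
    Tendsto (fun n : ℕ => translate (n * p) (n * q) (x ⊓ y)) atTop (𝓝 (u ⊓ v)) := by
  simp only [translate_inf]
  rw [tendsto_pi_nhds] at *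
  exact fun i => (hx i).inf_nhds (hy i)

theorem tendsto_translate_mul_sup {p q : ℤ} {x y u v : ℤ → ℝ}
    (hx : Tendsto (fun n : ℕ => translate (n * p) (n * q) x) atTop (𝓝 u))
    (hy : Tendsto (fun n : ℕ => translate (n * p) (n * q) y) atTop (𝓝 v)) :
    Tendsto (fun n : ℕ => translate (n * p) (n * q) (x ⊔ y)) atTop (𝓝 (u ⊔ v)) := by
  simp only [translate_sup]
  rw [tendsto_pi_nhds] at *
  exact fun i => (hx i).sup_nhds (hy i)

theorem le_or_le_of_limits_le (hS : IsWeakTwistLocalEnergy S) {p q : ℤ} (hp : 0 < p) {x y : ℤ → ℝ}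
    (hx : IsGlobalMinimizer S x) (hy : IsGlobalMinimizer S y)
    {u v u' v' : ℤ → ℝ}
    (hxu : Tendsto (fun n : ℕ => translate (n * p) (n * q) x) atTop (𝓝 u))
    (hyv : Tendsto (fun n : ℕ => translate (n * p) (n * q) y) atTop (𝓝 v))
    (hxu' : Tendsto (fun n : ℕ => translate (n * -p) (n * -q) x) atTop (𝓝 u'))
    (hyv' : Tendsto (fun n : ℕ => translate (n * -p) (n * -q) y) atTop (𝓝 v'))
    (h : u ≤ v) (h' : u' ≤ v') : x ≤ y ∨ y ≤ x := by
  refine le_or_le_of_isGlobalMinimizer_inf hS hx hy ?_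
  refine isGlobalMinimizer_of_same_limits hS.contDiff.continuous hS.periodic hp hx hy
    (action_inf_add_action_sup_le hS.submodular · · x y) hxu ?_ hyv ?_ hxu' ?_ hyv' ?_
  · exact inf_eq_left.2 h ▸ tendsto_translate_mul_inf hxu hyv
  · simpa only [sup_eq_right.2 h] using tendsto_translate_mul_sup hxu hyv
  · exact inf_eq_left.2 h' ▸ tendsto_translate_mul_inf hxu' hyv'
  · simpa only [sup_eq_right.2 h'] using tendsto_translate_mul_sup hxu' hyv'

theorem le_or_le_of_periodic (hS : IsWeakTwistLocalEnergy S) {p q : ℤ} (hp : 0 < p) {x y : ℤ → ℝ}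
    (hx : IsGlobalMinimizer S x) (hy : IsGlobalMinimizer S y)
    (hxp : translate p q x = x) (hyp : translate p q y = y) :
    x ≤ y ∨ y ≤ x :=
  le_or_le_of_isGlobalMinimizer_inf hS hx hy
    (isGlobalMinimizer_inf_of_periodic hS.periodic hS.submodular hp hx hy hxp hyp)

/-- A minimizer is comparable with a periodic minimizer lying between its limits. -/
theorem le_or_le_of_between (hS : IsWeakTwistLocalEnergy S) {p q : ℤ} (hp : 0 < p) {x y : ℤ → ℝ}
    (hx : IsGlobalMinimizer S x) (hy : IsGlobalMinimizer S y)
    {v v' : ℤ → ℝ} (hxp : translate p q x = x)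
    (hyv : Tendsto (fun n : ℕ => translate (n * p) (n * q) y) atTop (𝓝 v))
    (hyv' : Tendsto (fun n : ℕ => translate (n * -p) (n * -q) y) atTop (𝓝 v'))
    (h : v' ≤ x ∧ x ≤ v ∨ v ≤ x ∧ x ≤ v') : y ≤ x ∨ x ≤ y := by
  have hc := hS.contDiff.continuous
  have hv' : IsGlobalMinimizer S v' := isGlobalMinimizer_of_tendsto_translate hc hS.periodic hy hyv'
  have hvp' : translate p q v' = v' := translate_eq_self_of_neg (translate_eq_self_of_tendsto hyv')
  have hxt : Tendsto (fun n : ℕ => translate (n * p) (n * q) x) atTop (𝓝 x) :=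
    tendsto_const_nhds.congr fun n => (translate_mul_eq_self hxp n).symm
  have hxt' : Tendsto (fun n : ℕ => translate (n * -p) (n * -q) x) atTop (𝓝 x) :=
    tendsto_const_nhds.congr fun n => by
      rw [← neg_mul_comm, ← neg_mul_comm, translate_mul_eq_self hxp]
  have hsub := (action_inf_add_action_sup_le hS.submodular · · y x)
  rcases h with ⟨h', h⟩ | ⟨h, h'⟩
  · refine le_or_le_of_isGlobalMinimizer_inf hS hy hx ?_
    refine isGlobalMinimizer_of_between hc hS.periodic hp (a := y ⊔ x) hy hx hv' hxp hvp'
      (fun s t => (add_comm _ _).trans_le (hsub s t)) hyv ?_ ?_ hyv' ?_ ?_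
    · exact sup_eq_left.2 h ▸ tendsto_translate_mul_sup hyv hxt
    · simpa only [inf_eq_right.2 h] using tendsto_translate_mul_inf hyv hxt
    · simpa only [sup_eq_right.2 h'] using tendsto_translate_mul_sup hyv' hxt'
    · exact inf_eq_left.2 h' ▸ tendsto_translate_mul_inf hyv' hxt'
  · refine le_or_le_of_isGlobalMinimizer_sup hS hy hx ?_
    refine isGlobalMinimizer_of_between hc hS.periodic hp (a := y ⊓ x) hy hx hv' hxp hvp'
      hsub hyv ?_ ?_ hyv' ?_ ?_
    · exact inf_eq_left.2 h ▸ tendsto_translate_mul_inf hyv hxt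
    · simpa only [sup_eq_right.2 h] using tendsto_translate_mul_sup hyv hxt
    · simpa only [inf_eq_right.2 h'] using tendsto_translate_mul_inf hyv' hxt'
    · exact sup_eq_left.2 h' ▸ tendsto_translate_mul_sup hyv' hxt'

/-- Minimizers whose limits are ordered in the same way are comparable. -/
theorem le_or_le_of_limits (hS : IsWeakTwistLocalEnergy S) {p q : ℤ} (hp : 0 < p) {x y : ℤ → ℝ}
    (hx : IsGlobalMinimizer S x) (hy : IsGlobalMinimizer S y)
    {u v u' v' : ℤ → ℝ}
    (hxu : Tendsto (fun n : ℕ => translate (n * p) (n * q) x) atTop (𝓝 u))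
    (hyv : Tendsto (fun n : ℕ => translate (n * p) (n * q) y) atTop (𝓝 v))
    (hxu' : Tendsto (fun n : ℕ => translate (n * -p) (n * -q) x) atTop (𝓝 u'))
    (hyv' : Tendsto (fun n : ℕ => translate (n * -p) (n * -q) y) atTop (𝓝 v'))
    (h : u' ≤ u ∧ v' ≤ v ∨ u ≤ u' ∧ v ≤ v') : x ≤ y ∨ y ≤ x := by
  have hc := hS.contDiff.continuous
  have hu := isGlobalMinimizer_of_tendsto_translate hc hS.periodic hx hxu
  have hv := isGlobalMinimizer_of_tendsto_translate hc hS.periodic hy hyv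
  have hu' := isGlobalMinimizer_of_tendsto_translate hc hS.periodic hx hxu'
  have hv' := isGlobalMinimizer_of_tendsto_translate hc hS.periodic hy hyv'
  have hup := translate_eq_self_of_tendsto hxu
  have hvp := translate_eq_self_of_tendsto hyv
  have hup' := translate_eq_self_of_neg (translate_eq_self_of_tendsto hxu')
  have hvp' := translate_eq_self_of_neg (translate_eq_self_of_tendsto hyv')
  -- limits preserve comparison with periodic sequences
  have hle : ∀ {a b c : ℤ → ℝ} {p' q' : ℤ}, a ≤ b → translate p' q' b = b →
      Tendsto (fun n : ℕ => translate (n * p') (n * q') a) atTop (𝓝 c) → c ≤ b := by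
    intro a b c p' q' hab hb hac
    refine le_of_tendsto' hac fun n => ?_
    exact (translate_mono _ _ hab).trans_eq (translate_mul_eq_self hb n)
  have hge : ∀ {a b c : ℤ → ℝ} {p' q' : ℤ}, b ≤ a → translate p' q' b = b →
      Tendsto (fun n : ℕ => translate (n * p') (n * q') a) atTop (𝓝 c) → b ≤ c := by
    intro a b c p' q' hab hb hac
    refine ge_of_tendsto' hac fun n => ?_
    exact (translate_mul_eq_self hb n).symm.trans_le (translate_mono _ _ hab)
  have hxy := le_or_le_of_limits_le hS hp hx hy hxu hyv hxu' hyv'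
  have hyx := fun h1 h2 => (le_or_le_of_limits_le hS hp hy hx hyv hxu hyv' hxu' h1 h2).symm
  rcases le_or_le_of_periodic hS hp hu hv hup hvp with h1 | h1 <;>
    rcases le_or_le_of_periodic hS hp hu' hv' hup' hvp' with h2 | h2
  · exact hxy h1 h2
  · rcases h with ⟨h3, h4⟩ | ⟨h3, h4⟩
    -- The limits are nested, `v' ≤ u' ≤ u ≤ v`. If `y ≤ u'` then `v ≤ u`; if `u' ≤ y` then `u' ≤
    -- v'`. Either way the orders at the two ends can be matched. The other crossed cases are
    -- analogous.
    · rcases le_or_le_of_between hS hp hu' hy hup' hyv hyv' (Or.inl ⟨h2, h3.trans h1⟩) with h5 | h5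
      · exact hyx ((hle h5 hup' hyv).trans h3) h2
      · exact hxy h1 (hge h5 (translate_eq_self_of_tendsto hxu') hyv')
    · rcases le_or_le_of_between hS hp hv hx hvp hxu hxu' (Or.inr ⟨h1, h4.trans h2⟩) with h5 | h5
      · exact hxy h1 ((hle h5 (translate_eq_self_of_neg (by simpa using hvp)) hxu').trans h4)
      · exact hyx (hge h5 hvp hxu) h2
  · rcases h with ⟨h3, h4⟩ | ⟨h3, h4⟩
    · rcases le_or_le_of_between hS hp hv' hx hvp' hxu hxu' (Or.inl ⟨h2, h4.trans h1⟩) with h5 | h5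
      · exact hxy ((hle h5 hvp' hxu).trans h4) h2
      · exact hyx h1 (hge h5 (translate_eq_self_of_tendsto hyv') hxu')
    · rcases le_or_le_of_between hS hp hu hy hup hyv hyv' (Or.inr ⟨h1, h3.trans h2⟩) with h5 | h5
      · exact hyx h1 ((hle h5 (translate_eq_self_of_neg (by simpa using hup)) hyv').trans h3)
      · exact hxy (hge h5 hup hyv) h2
  · exact hyx h1 h2

/-! ### Reversal of `(p, q)` and total ordering. -/

theorem translate_le_iff {p q : ℤ} {x y : ℤ → ℝ} :
    translate p q x ≤ y ↔ x ≤ translate (-p) (-q) y := by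
  constructor
  · intro h
    simpa [translate_translate, translate_zero] using translate_mono (-p) (-q) h
  · intro h
    simpa [translate_translate, translate_zero] using translate_mono p q h

theorem exists_limits_of_le {p q : ℤ} (hp : p ≠ 0) {x : ℤ → ℝ}
    (hx : x ∈ birkhoffMinimizers S ((q : ℝ) / p)) (h : x ≤ translate p q x) :
    ∃ u u' : ℤ → ℝ, Tendsto (fun n : ℕ => translate (n * p) (n * q) x) atTop (𝓝 u) ∧
      Tendsto (fun n : ℕ => translate (n * -p) (n * -q) x) atTop (𝓝 u') ∧ u' ≤ u :=
  exists_tendsto_translate_mul h (translate_mul_le hp hx.2.1 hx.2.2)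
    (le_translate_mul_add_one hp hx.2.1 hx.2.2)

theorem birkhoffMinimizersPlus_neg (p q : ℤ) :
    birkhoffMinimizersPlus S (-p) (-q) = birkhoffMinimizersMinus S p q := by
  ext x
  simp only [birkhoffMinimizersPlus, birkhoffMinimizersMinus, Set.mem_ofPred_eq, translate_le_iff]
  push_cast
  rw [neg_div_neg_eq]

theorem exists_limits_of_ge {p q : ℤ} (hp : p ≠ 0) {x : ℤ → ℝ}
    (hx : x ∈ birkhoffMinimizersMinus S p q) :
    ∃ u u' : ℤ → ℝ, Tendsto (fun n : ℕ => translate (n * p) (n * q) x) atTop (𝓝 u) ∧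
      Tendsto (fun n : ℕ => translate (n * -p) (n * -q) x) atTop (𝓝 u') ∧ u ≤ u' := by
  rw [← birkhoffMinimizersPlus_neg] at hx
  obtain ⟨u, u', h1, h2, h3⟩ := exists_limits_of_le (neg_ne_zero.2 hp) hx.1 hx.2
  simp only [neg_neg] at h2
  exact ⟨u', u, h2, h1, h3⟩

theorem isChain_of_pos (hS : IsWeakTwistLocalEnergy S) {p q : ℤ} (hp : 0 < p) :
    IsChain (· ≤ ·) (birkhoffMinimizersPlus S p q) ∧
      IsChain (· ≤ ·) (birkhoffMinimizersMinus S p q) := by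
  constructor
  · intro x hx y hy _
    obtain ⟨u, u', h1, h2, h3⟩ := exists_limits_of_le hp.ne' hx.1 hx.2
    obtain ⟨v, v', k1, k2, k3⟩ := exists_limits_of_le hp.ne' hy.1 hy.2
    exact le_or_le_of_limits hS hp hx.1.1 hy.1.1 h1 k1 h2 k2 (Or.inl ⟨h3, k3⟩)
  · intro x hx y hy _
    obtain ⟨u, u', h1, h2, h3⟩ := exists_limits_of_ge hp.ne' hx
    obtain ⟨v, v', k1, k2, k3⟩ := exists_limits_of_ge hp.ne' hy
    exact le_or_le_of_limits hS hp hx.1.1 hy.1.1 h1 k1 h2 k2 (Or.inr ⟨h3, k3⟩)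

end FrenkelKontorova

theorem mainTheorem6 {r : ℕ} (S : (Fin (r + 1) → ℝ) → ℝ)
    (hS : FrenkelKontorova.IsWeakTwistLocalEnergy S) (p q : ℤ) (hp : p ≠ 0) :
    IsChain (· ≤ ·) (FrenkelKontorova.birkhoffMinimizersPlus S p q) ∧
      IsChain (· ≤ ·) (FrenkelKontorova.birkhoffMinimizersMinus S p q) := by
  -- Negating `(p, q)` exchanges the two sets, which reduces to `p > 0`.
  rcases lt_or_gt_of_ne hp with h | h
  · have := FrenkelKontorova.isChain_of_pos hS (p := -p) (q := -q) (by omega)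
    have e := FrenkelKontorova.birkhoffMinimizersPlus_neg (S := S) (-p) (-q)
    rw [neg_neg, neg_neg] at e
    rw [FrenkelKontorova.birkhoffMinimizersPlus_neg, ← e] at this
    exact this.symm
  · exact FrenkelKontorova.isChain_of_pos hS h
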